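/- All graphs are finite and simple, and the null graph (no vertices) is allowed. A graph is a \emph{path} if it is isomorphic to the path on $n$ vertices for some integer $n\ge 0$. A \emph{fan} is a graph $X$ that becomes a path by the removal of at most one vertex. A graph $G$ is \emph{$X$-minor-free} if there is no family $(B_x \mid x\in V(X))$ of pairwise disjoint subsets of $V(G)$ such that each $B_x$ induces a non-empty connected subgraph of $G$ and, for every edge $xy$ of $X$, there is an edge of $G$ between $B_x$ and $B_y$. An \emph{elimination forest} of $G$ is a rooted forest $F$ with $V(F)=V(G)$ such that for every edge $uv$ of $G$, one of $u,v$ lies on the path in $F$ from a root to the other. The \emph{treedepth} $\operatorname{td}(G)$ is the minimum, over all elimination forests $F$ of $G$, of the maximum number of vertices on a root-to-leaf path in $F$ (and $\operatorname{td}(G)=0$ if $G$ is null). The \emph{diameter} $\operatorname{diam}(G)$ of a connected graph $G$ is the maximum distance between two vertices of $G$ (and $0$ if $G$ is null). \textbf{Corollary.} Let $X$ be a fan with at least three vertices, and let $G$ be a connected graph (possibly null). If $G$ is $X$-minor-free, then \[ \operatorname{td}(G)\;\le\;\binom{|V(X)|-1}{2}\,\bigl(\operatorname{diam}(G)+1\bigr).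 \] -/

import Mathlib

namespace FanMinor

/-- A graph is a path if it is isomorphic to the path on `n` vertices for some `n : ℕ`;
the null graph (`n = 0`) is a path. -/
def IsPathGraph {W : Type*} (X : SimpleGraph W) : Prop :=
  ∃ n : ℕ, Nonempty (X ≃g SimpleGraph.pathGraph n)

/-- A fan (apex-path): a graph that becomes a path by removing at most one vertex. -/
def IsFan {W : Type*} (X : SimpleGraph W) : Prop :=
  IsPathGraph X ∨ ∃ w : W, IsPathGraph (X.induce {w}ᶜ)

/-- `B` is a model of `H` in `G`: the branch sets are pairwise disjoint, each of them induces a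
non-empty connected subgraph of `G` (`SimpleGraph.Connected` includes non-emptiness), and
adjacent vertices of `H` have branch sets joined by an edge of `G`. -/
structure IsModel {W V : Type*} (H : SimpleGraph W) (G : SimpleGraph V) (B : W → Set V) :
    Prop where
  disjoint : ∀ x y : W, x ≠ y → Disjoint (B x) (B y)
  connected : ∀ x : W, (G.induce (B x)).Connected
  adj : ∀ x y : W, H.Adj x y → ∃ u ∈ B x, ∃ v ∈ B y, G.Adj u v

/-- `H` is a minor of `G` if `G` contains a model of `H`. -/
def IsMinor {W V : Type*} (H : SimpleGraph W) (G : SimpleGraph V) : Prop :=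
  ∃ B : W → Set V, IsModel H G B

/-- A rooted forest with vertex set `V`: an acyclic graph with a chosen vertex (the root) in each
of its connected components. -/
structure RootedForest (V : Type*) where
  graph : SimpleGraph V
  isAcyclic : graph.IsAcyclic
  root : graph.ConnectedComponent → V
  root_mem : ∀ c : graph.ConnectedComponent, graph.connectedComponentMk (root c) = c

namespace RootedForest

variable {V : Type*}

/-- The root of the component of `u`. -/
def rootOf (F : RootedForest V) (u : V) : V :=
  F.root (F.graph.connectedComponentMk u)

/-- `u` is a descendant of `v`: the vertex `v` lies on the path from the root to `u`. -/
def IsDescendant (F : RootedForest V) (u v : V) : Prop :=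
  ∃ p : F.graph.Walk (F.rootOf u) u, p.IsPath ∧ v ∈ p.support

/-- The depth of `u`: the number of vertices on the path between `u` and the root of its
component. -/
noncomputable def depth (F : RootedForest V) (u : V) : ℕ :=
  {v : V | F.IsDescendant u v}.ncard

/-- The vertex-height: the maximum number of vertices on a path from a root to a leaf. Since
every path that starts at a root extends to a leaf, this is the maximum depth of a vertex
(`0` for the null forest). -/
noncomputable def vertexHeight [Fintype V] (F : RootedForest V) : ℕ :=
  Finset.univ.sup F.depth

/-- The closure of `F`: distinct vertices are adjacent iff one is a descendant of the other. -/
def closure (F : RootedForest V) : SimpleGraph V :=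
  SimpleGraph.fromRel F.IsDescendant

/-- `F`, on the same vertex set as `G`, is an elimination forest of `G`. -/
def IsEliminationForest (F : RootedForest V) (G : SimpleGraph V) : Prop :=
  G ≤ F.closure

end RootedForest

/-- The treedepth of a finite graph: the minimum vertex-height of an elimination forest. (Every
finite graph has one, a path through all vertices rooted at an end; it is `0` for the null
graph.) -/
noncomputable def treedepth {V : Type*} [Fintype V] (G : SimpleGraph V) : ℕ :=
  sInf {h : ℕ | ∃ F : RootedForest V, F.IsEliminationForest G ∧ F.vertexHeight = h}

end FanMinor

/-! Put |V(X)| = n + 2 and call a ranking of the vertices good when two vertices of equal rank are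
always separated by those of smaller rank. A good ranking with k ranks gives an elimination forest
of height at most k (`IsFocusedRanking.treedepth_le`), so few ranks must suffice.

Fix a vertex r. A ball around r is connected and each vertex of the next sphere S has a neighbour in
it. A path model on n + 1 branch sets outside the ball, each meeting S, would therefore form
together with the ball a model of X. So there is none, and `exists_focusedRanking` ranks S with C(n
+ 1, 2) ranks; vertices beyond S may stay unranked, which is encoded as a rank at or above the
bound. Stacking these rankings sphere by sphere, at most diam(G) times, and giving r a rank of its
own proves the bound.

The core is a hitting set. In one component without an S-rooted path model on n + 1 branch sets, any
two such models on n branch sets intersect, since disjoint ones could be merged into a longer one.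
Hence some path P meets all of them. By Menger's theorem, either n + 1 disjoint legs join P to S,
which again gives the forbidden model, or at most n vertices separate P from S and hit every model.
Ranking these first and recursing costs n + (n - 1) + ... + 1 ranks. -/

namespace FanMinor

/-! ### Walks confined to a vertex set -/

section Linked

variable {V : Type*} {G H : SimpleGraph V} {D E : Set V} {a b c : V}

/-- Some walk from `a` to `b` stays inside `D`. -/
def Linked (G : SimpleGraph V) (D : Set V) (a b : V) : Prop :=
  ∃ p : G.Walk a b, ∀ w ∈ p.support, w ∈ D

theorem Linked.left_mem (h : Linked G D a b) : a ∈ D :=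
  let ⟨p, hp⟩ := h; hp _ p.start_mem_support

theorem Linked.right_mem (h : Linked G D a b) : b ∈ D :=
  let ⟨p, hp⟩ := h; hp _ p.end_mem_support

theorem Linked.refl (h : a ∈ D) : Linked G D a a :=
  ⟨.nil, by simpa using h⟩

theorem Linked.symm (h : Linked G D a b) : Linked G D b a := by
  obtain ⟨p, hp⟩ := h
  exact ⟨p.reverse, by simpa using hp⟩

theorem Linked.trans (h : Linked G D a b) (h' : Linked G D b c) : Linked G D a c := by
  obtain ⟨p, hp⟩ := h
  obtain ⟨q, hq⟩ := h'
  refine ⟨p.append q, fun w hw => ?_⟩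
  rcases (SimpleGraph.Walk.mem_support_append_iff _ _).1 hw with h | h
  exacts [hp _ h, hq _ h]

theorem Linked.mono (h : Linked G D a b) (hD : D ⊆ E) : Linked G E a b :=
  let ⟨p, hp⟩ := h; ⟨p, fun w hw => hD (hp w hw)⟩

theorem Linked.mono_graph (h : Linked G D a b) (hG : G ≤ H) : Linked H D a b := by
  obtain ⟨p, hp⟩ := h
  exact ⟨p.mapLe hG, by simpa using hp⟩

theorem Linked.of_adj (h : G.Adj a b) (ha : a ∈ D) (hb : b ∈ D) : Linked G D a b :=
  ⟨h.toWalk, by simp [ha, hb]⟩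

theorem Linked.head_induction {P : V → Prop} (h : Linked G D a b) (base : b ∈ D → P b)
    (step : ∀ x y, x ∈ D → G.Adj x y → Linked G D y b → P y → P x) : P a := by
  obtain ⟨p, hp⟩ := h
  induction p with
  | nil => exact base (hp _ (by simp))
  | cons hadj p ih =>
    have hp' : ∀ w ∈ p.support, w ∈ D := fun w hw => hp w (by simp [hw])
    exact step _ _ (hp _ (by simp)) hadj ⟨p, hp'⟩ (ih base step hp')

/-- A walk inside `D` stays in any set `E` that is closed under steps inside `D`. -/
theorem Linked.of_closed (h : Linked G D a b) (ha : a ∈ E)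
    (hE : ∀ x ∈ E, ∀ y ∈ D, G.Adj x y → y ∈ E) : Linked G E a b := by
  revert ha
  refine h.head_induction (P := fun x => x ∈ E → Linked G E x b) (fun _ ha => Linked.refl ha) ?_
  intro x y hx hxy hyb ih hxE
  have hy := hE x hxE y hyb.left_mem hxy
  exact (Linked.of_adj hxy hxE hy).trans (ih hy)

/-- The part of a walk up to its first vertex in `T`. -/
theorem Linked.first_hit {T : Set V} (h : Linked G D a b) (hb : b ∈ T) :
    ∃ t ∈ T, t ∈ D ∧ Linked G (insert t {v | Linked G (D \ T) a v}) a t := by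
  refine h.head_induction
    (P := fun x => ∃ t ∈ T, t ∈ D ∧ Linked G (insert t {v | Linked G (D \ T) x v}) x t)
    (fun hD => ⟨b, hb, hD, Linked.refl (by simp)⟩) ?_
  -- The supporting set is the whole `D \ T`-component plus `t`, not only a walk prefix; it meets
  -- `T` just in `t`, and it can only grow when the walk is extended backwards.
  intro x y hx hxy _ ⟨t, htT, htD, ht⟩
  by_cases hxT : x ∈ T
  · exact ⟨x, hxT, hx, Linked.refl (by simp)⟩
  refine ⟨t, htT, htD, ?_⟩
  have hxx : Linked G (D \ T) x x := Linked.refl ⟨hx, hxT⟩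
  have hsub : insert t {v | Linked G (D \ T) y v} ⊆ insert t {v | Linked G (D \ T) x v} := by
    rintro v (rfl | hv)
    · exact .inl rfl
    · exact .inr ((Linked.of_adj (D := D \ T) hxy ⟨hx, hxT⟩ (Linked.left_mem hv)).trans hv)
  have ht' := ht.mono hsub
  exact (Linked.of_adj hxy (.inr hxx) ht'.left_mem).trans ht'

theorem Linked.deleteEdge {x y : V} (h : Linked G D a b) (hxy : x ∉ D ∨ y ∉ D) :
    Linked (G.deleteEdges {s(x, y)}) D a b := by
  refine h.head_induction (P := fun u => Linked (G.deleteEdges {s(x, y)}) D u b)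
    (fun hb => Linked.refl hb) ?_
  intro u v hu huv hv ih
  refine (Linked.of_adj ?_ hu hv.left_mem).trans ih
  rw [SimpleGraph.deleteEdges_adj]
  refine ⟨huv, ?_⟩
  have := hv.left_mem
  simp only [Set.mem_singleton_iff, Sym2.eq_iff]
  rintro (⟨rfl, rfl⟩ | ⟨rfl, rfl⟩) <;> tauto

/-- Every two vertices of `B` are joined by a walk inside `B`. -/
def IsConnectedSet (G : SimpleGraph V) (B : Set V) : Prop :=
  ∀ u ∈ B, ∀ v ∈ B, Linked G B u v

theorem Linked.component_self {a v : V} (h : Linked G D a v) :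
    Linked G {w | Linked G D a w} a v :=
  h.of_closed (Linked.refl h.left_mem) fun _ hx _ hy hxy =>
    Linked.trans hx (Linked.of_adj hxy hx.right_mem hy)

theorem isConnectedSet_component (a : V) : IsConnectedSet G {v | Linked G D a v} :=
  fun _ hu _ hv => (Linked.component_self hu).symm.trans (Linked.component_self hv)

theorem IsConnectedSet.union {B C : Set V} (hB : IsConnectedSet G B) (hC : IsConnectedSet G C)
    {x y : V} (hx : x ∈ B) (hy : y ∈ C) (hxy : Linked G (B ∪ C) x y) :
    IsConnectedSet G (B ∪ C) := by
  have key : ∀ u ∈ B ∪ C, Linked G (B ∪ C) u x := by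
    rintro u (hu | hu)
    · exact (hB u hu x hx).mono Set.subset_union_left
    · exact ((hC u hu y hy).mono Set.subset_union_right).trans hxy.symm
  exact fun u hu v hv => (key u hu).trans (key v hv).symm

theorem IsConnectedSet.mono_graph {B : Set V} (hB : IsConnectedSet G B) (hG : G ≤ H) :
    IsConnectedSet H B :=
  fun u hu v hv => (hB u hu v hv).mono_graph hG

theorem IsConnectedSet.induce_connected {B : Set V} (hB : IsConnectedSet G B)
    (hne : B.Nonempty) : (G.induce B).Connected := by
  obtain ⟨x, hx⟩ := hne
  have : Nonempty B := ⟨⟨x, hx⟩⟩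
  refine SimpleGraph.Connected.mk fun u v => ?_
  obtain ⟨p, hp⟩ := hB u u.2 v v.2
  exact ⟨p.induce B hp⟩

end Linked

/-! ### Menger's theorem, by deleting edges -/

section Menger

variable {V : Type*}

/-- `Z` meets every walk from `A` to `B`. -/
def Separates (G : SimpleGraph V) (A B Z : Set V) : Prop :=
  ∀ a ∈ A, ∀ b ∈ B, ¬ Linked G Zᶜ a b

/-- There are `k` pairwise disjoint sets, each of which supports a walk from `A` to `B`. -/
def DisjointlyLinked (G : SimpleGraph V) (A B : Set V) (k : ℕ) : Prop :=
  ∃ C : Fin k → Set V, Pairwise (fun i j => Disjoint (C i) (C j)) ∧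
    ∀ i, ∃ a ∈ A, ∃ b ∈ B, Linked G (C i) a b

variable {G : SimpleGraph V} {A B Z : Set V}

theorem Separates.symm (h : Separates G A B Z) : Separates G B A Z :=
  fun b hb a ha hl => h a ha b hb hl.symm

theorem DisjointlyLinked.symm {k : ℕ} (h : DisjointlyLinked G A B k) :
    DisjointlyLinked G B A k := by
  obtain ⟨C, hC, h⟩ := h
  refine ⟨C, hC, fun i => ?_⟩
  obtain ⟨a, ha, b, hb, hl⟩ := h i
  exact ⟨b, hb, a, ha, hl.symm⟩

/-- Disjoint links from `A` to a `k`-set `T` can be indexed by their ends in `T` and chosen so that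
each of them meets `T` only in its end. -/
theorem DisjointlyLinked.exists_indexed [Finite V] {T : Set V} {k : ℕ} (h : DisjointlyLinked G A T k)
    (hT : T.ncard = k) :
    ∃ P : V → Set V, (∀ s ∈ T, ∀ t ∈ T, s ≠ t → Disjoint (P s) (P t)) ∧
      (∀ t ∈ T, ∃ a ∈ A, Linked G (P t) a t) ∧
      ∀ t ∈ T, ∀ v ∈ P t, v = t ∨ ∃ a ∈ A, Linked G Tᶜ a v := by
  obtain ⟨C, hC, h⟩ := h
  choose a ha b hb hl using h
  choose t htT htC ht using fun i => (hl i).first_hit (hb i)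
  have hinj : Function.Injective t := by
    intro i j hij
    by_contra hne
    exact Set.disjoint_left.1 (hC hne) (htC i) (hij ▸ htC j)
  -- `k` distinct ends exhaust the `k`-set `T`, so the ends can serve as indices.
  have hrange : Set.range t = T := by
    refine Set.eq_of_subset_of_ncard_le (Set.range_subset_iff.2 htT) ?_ (Set.toFinite _)
    rw [hT, Set.ncard_range_of_injective hinj]
    simp
  let Q : Fin k → Set V := fun i => insert (t i) {v | Linked G (C i \ T) (a i) v}
  have hQC : ∀ i, Q i ⊆ C i := by
    rintro i v (rfl | hv)
    · exact htC i
    · exact (Linked.right_mem hv).1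
  refine ⟨Function.extend t Q fun _ => ∅, ?_, ?_, ?_⟩
  · intro s hs s' hs' hne
    rw [← hrange] at hs hs'
    obtain ⟨i, rfl⟩ := hs
    obtain ⟨j, rfl⟩ := hs'
    rw [hinj.extend_apply, hinj.extend_apply]
    exact (hC fun h => hne (by rw [h])).mono (hQC i) (hQC j)
  · intro s hs
    rw [← hrange] at hs
    obtain ⟨i, rfl⟩ := hs
    rw [hinj.extend_apply]
    exact ⟨a i, ha i, ht i⟩
  · intro s hs
    rw [← hrange] at hs
    obtain ⟨i, rfl⟩ := hs
    rw [hinj.extend_apply]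
    rintro v (rfl | hv)
    · exact .inl rfl
    · exact .inr ⟨a i, ha i, Linked.mono hv fun w hw => hw.2⟩

theorem menger_bot [Finite V] {k : ℕ} (h : ∀ Z, Separates (⊥ : SimpleGraph V) A B Z → k ≤ Z.ncard) :
    DisjointlyLinked (⊥ : SimpleGraph V) A B k := by
  have hsep : Separates (⊥ : SimpleGraph V) A B (A ∩ B) := by
    rintro a ha b hb hl
    have hab : a ∈ B :=
      (hl.symm.of_closed (E := B) hb fun x _ y _ hxy => absurd hxy (by simp)).right_mem
    exact hl.left_mem ⟨ha, hab⟩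
  have hk := h _ hsep
  obtain ⟨T, hT, hTk⟩ := Set.exists_subset_card_eq hk
  have e : Fin k ≃ T := (Finite.equivFinOfCardEq (by rw [← hTk]; rfl)).symm
  refine ⟨fun i => {(e i : V)}, fun i j hij => ?_, fun i => ?_⟩
  · simpa [Subtype.ext_iff] using fun h => hij (e.injective (Subtype.ext h))
  · exact ⟨e i, (hT (e i).2).1, e i, (hT (e i).2).2, Linked.refl rfl⟩

/-- Prepares one side of the gluing: outside `Z`, every vertex of a link, including the end `x`, is
reachable from `A` around `Z`. A crossing of links from opposite sides would then evade `Z`. -/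
theorem exists_links_avoiding [Finite V] {k : ℕ} {x : V} (hxZ : x ∉ Z) (hk : Z.ncard + 1 = k)
    (hA : DisjointlyLinked G A (insert x Z) k) :
    ∃ P : V → Set V, (∀ s ∈ insert x Z, ∀ t ∈ insert x Z, s ≠ t → Disjoint (P s) (P t)) ∧
      (∀ t ∈ insert x Z, ∃ a ∈ A, Linked G (P t) a t) ∧
      (∀ t ∈ insert x Z, ∀ v ∈ P t, v ∈ Z → v = t) ∧
      ∀ t ∈ insert x Z, ∀ v ∈ P t, v ∉ Z → ∃ a ∈ A, Linked G Zᶜ a v := by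
  obtain ⟨P, hPd, hPl, hPv⟩ := hA.exists_indexed (by rw [Set.ncard_insert_of_notMem hxZ, hk])
  have hP : ∀ t ∈ insert x Z, ∀ v ∈ P t, v = t ∨ ∃ a ∈ A, Linked G Zᶜ a v := by
    intro t ht v hv
    refine (hPv t ht v hv).imp_right fun ⟨a, ha, hl⟩ => ⟨a, ha, hl.mono ?_⟩
    exact Set.compl_subset_compl.2 (Set.subset_insert _ _)
  refine ⟨P, hPd, hPl, fun t ht v hv hvZ => ?_, fun t ht v hv hvZ => ?_⟩
  · exact (hP t ht v hv).resolve_right fun ⟨a, _, hl⟩ => hl.right_mem hvZ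
  · rcases hP t ht v hv with rfl | h
    · obtain rfl : v = x := ht.resolve_right hvZ
      obtain ⟨a, ha, hl⟩ := hPl v ht
      refine ⟨a, ha, hl.mono fun w hw => ?_⟩
      rcases hP v ht w hw with rfl | ⟨_, _, h⟩
      exacts [hvZ, h.right_mem]
    · exact h

/-- The step of the proof of Menger's theorem in which two systems of links are glued along a
separator `Z` of `G'` and the edge `xy`. -/
theorem DisjointlyLinked.glue [Finite V] {G' : SimpleGraph V} {k : ℕ} {x y : V} (hG' : G' ≤ G)
    (hxy : G.Adj x y) (hZ : Separates G' A B Z) (hxZ : x ∉ Z) (hyZ : y ∉ Z)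
    (hk : Z.ncard + 1 = k) (hA : DisjointlyLinked G' A (insert x Z) k)
    (hB : DisjointlyLinked G' (insert y Z) B k) : DisjointlyLinked G A B k := by
  classical
  obtain ⟨P, hPd, hPl, hPe, hPv⟩ := exists_links_avoiding hxZ hk hA
  obtain ⟨Q, hQd, hQl, hQe, hQv⟩ := exists_links_avoiding hyZ hk hB.symm
  have e : Fin k ≃ (insert y Z : Set V) :=
    (Finite.equivFinOfCardEq (by rw [← hk, ← Set.ncard_insert_of_notMem hyZ]; rfl)).symm
  -- Pairs the ends: links with the same end in `Z` are glued there, and the links ending in `x` and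
  -- `y` are joined by the edge.
  let φ : V → V := fun s => if s = y then x else s
  have hφ : ∀ s ∈ insert y Z, φ s ∈ insert x Z := by
    rintro s (rfl | hs)
    · simp [φ]
    · have : s ≠ y := fun h => hyZ (h ▸ hs)
      simp [φ, this, hs]
  have hφZ : ∀ s ∈ insert y Z, φ s ∈ Z → φ s = s := by
    intro s _ h
    by_cases hsy : s = y
    · simp [φ, hsy, hxZ] at h
    · simp [φ, hsy]
  have hφinj : ∀ s ∈ insert y Z, ∀ t ∈ insert y Z, φ s = φ t → s = t := by
    intro s hs t ht h
    by_cases hsy : s = y <;> by_cases hty : t = y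
    · rw [hsy, hty]
    · simp only [φ, hsy, hty, if_true, if_false] at h
      exact absurd (ht.resolve_left hty) (h ▸ hxZ)
    · simp only [φ, hsy, hty, if_true, if_false] at h
      exact absurd (hs.resolve_left hsy) (h ▸ hxZ)
    · simpa [φ, hsy, hty] using h
  have hPQ : ∀ s ∈ insert y Z, ∀ t ∈ insert y Z, s ≠ t → Disjoint (P (φ s)) (Q t) := by
    intro s hs t ht hst
    refine Set.disjoint_left.2 fun v hvP hvQ => ?_
    by_cases hvZ : v ∈ Z
    · have h1 := hPe _ (hφ s hs) v hvP hvZ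
      have h2 := hQe _ ht v hvQ hvZ
      exact hst ((hφZ s hs (h1 ▸ hvZ)).symm.trans (h1.symm.trans h2))
    · obtain ⟨a, ha, hl⟩ := hPv _ (hφ s hs) v hvP hvZ
      obtain ⟨b, hb, hl'⟩ := hQv _ ht v hvQ hvZ
      exact hZ a ha b hb (hl.trans hl'.symm)
  refine ⟨fun i => P (φ (e i)) ∪ Q (e i), fun i j hij => ?_, fun i => ?_⟩
  · have hne : (e i : V) ≠ e j := fun h => hij (e.injective (Subtype.ext h))
    refine Set.disjoint_union_left.2 ⟨Set.disjoint_union_right.2 ⟨?_, ?_⟩,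
      Set.disjoint_union_right.2 ⟨?_, ?_⟩⟩
    · exact hPd _ (hφ _ (e i).2) _ (hφ _ (e j).2) fun h => hne (hφinj _ (e i).2 _ (e j).2 h)
    · exact hPQ _ (e i).2 _ (e j).2 hne
    · exact (hPQ _ (e j).2 _ (e i).2 hne.symm).symm
    · exact hQd _ (e i).2 _ (e j).2 hne
  · obtain ⟨a, ha, hl⟩ := hPl _ (hφ _ (e i).2)
    obtain ⟨b, hb, hl'⟩ := hQl _ (e i).2
    have hl := (hl.mono_graph hG').mono (Set.subset_union_left (t := Q (e i)))
    have hl' := (hl'.mono_graph hG').mono (Set.subset_union_right (s := P (φ (e i))))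
    refine ⟨a, ha, b, hb, hl.trans (Linked.trans ?_ hl'.symm)⟩
    by_cases hy : (e i : V) = y
    · have : φ (e i) = x := by simp [φ, hy]
      refine Linked.of_adj ?_ hl.right_mem hl'.right_mem
      rw [this, hy]
      exact hxy
    · have : φ (e i) = e i := by simp [φ, hy]
      rw [this]
      rw [this] at hl
      exact Linked.refl hl.right_mem

/-- If `xy` is an edge whose deletion makes `Z` separate `A` from `B`, with `x` on the side of `A`,
then any set that separates `A` from `Z ∪ {x}` after the deletion separates `A` from `B`. -/
theorem Separates.of_insert {x y : V} {W : Set V} (hxy : x ≠ y)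
    (hZ : Separates (G.deleteEdges {s(x, y)}) A B Z)
    (hy : ∃ b ∈ B, Linked (G.deleteEdges {s(x, y)}) Zᶜ y b)
    (hW : Separates (G.deleteEdges {s(x, y)}) A (insert x Z) W) : Separates G A B W := by
  intro a ha b hb hl
  have hhit : ∃ t ∈ insert x Z, Linked G Wᶜ a t := by
    by_contra! hno
    have hl' : Linked G (insert x Z)ᶜ a b := by
      have hc : Linked G {v | Linked G Wᶜ a v} a b := hl.component_self
      exact hc.mono fun v hv hvT => hno v hvT hv
    refine hZ a ha b hb ((hl'.deleteEdge (.inl ?_)).mono ?_)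
    · simp
    · exact Set.compl_subset_compl.2 (Set.subset_insert _ _)
  obtain ⟨t', ht', hlt'⟩ := hhit
  obtain ⟨t, ht, htW, hlt⟩ := hlt'.first_hit ht'
  obtain ⟨b', hb', hyb⟩ := hy
  -- If `y` is reached before `x` and `Z`, going on to `B` evades `Z` without the edge. Otherwise
  -- the initial part up to `t` does not use the edge and evades `W`.
  by_cases hyt : Linked G (Wᶜ \ insert x Z) a y
  · have h1 := (hyt.deleteEdge (x := x) (y := y) (.inl (by simp))).mono (E := Zᶜ)
      fun w hw hwZ => hw.2 (.inr hwZ)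
    exact hZ a ha b' hb' (h1.trans hyb)
  · by_cases hty : t = y
    · subst hty
      exact ht.elim (fun h => hxy h.symm) hyb.left_mem
    · refine hW a ha t ht ((hlt.deleteEdge (x := x) (y := y) (.inr ?_)).mono ?_)
      · rintro (h | h)
        exacts [hty h.symm, hyt h]
      · rintro w (rfl | hw)
        exacts [htW, hw.right_mem.1]

/-- Menger's theorem. -/
theorem menger [Finite V] {k : ℕ} (h : ∀ Z, Separates G A B Z → k ≤ Z.ncard) :
    DisjointlyLinked G A B k := by
  classical
  induction G using WellFoundedLT.induction generalizing A B with
  | ind G ih =>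
  by_cases hG : G = ⊥
  · subst hG; exact menger_bot h
  obtain ⟨x, y, hxy⟩ := SimpleGraph.ne_bot_iff_exists_adj.1 hG
  have hle : G.deleteEdges {s(x, y)} ≤ G := SimpleGraph.deleteEdges_le _
  have hlt : G.deleteEdges {s(x, y)} < G := lt_of_le_of_ne hle fun he => by
    have : (G.deleteEdges {s(x, y)}).Adj x y := he.ge hxy
    simp at this
  by_cases hsep : ∀ Z, Separates (G.deleteEdges {s(x, y)}) A B Z → k ≤ Z.ncard
  · obtain ⟨C, hC, hl⟩ := ih _ hlt hsep
    refine ⟨C, hC, fun i => ?_⟩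
    obtain ⟨a, ha, b, hb, hl⟩ := hl i
    exact ⟨a, ha, b, hb, hl.mono_graph hle⟩
  push Not at hsep
  obtain ⟨Z, hZ, hZk⟩ := hsep
  -- Adding either end of the edge to `Z` separates in `G`, which forces `Z` to have exactly `k - 1`
  -- elements and to miss both ends.
  have hins : ∀ z, z = x ∨ z = y → Separates G A B (insert z Z) := by
    intro z hz a ha b hb hl
    refine hZ a ha b hb ((hl.deleteEdge ?_).mono ?_)
    · rcases hz with rfl | rfl
      exacts [.inl (by simp), .inr (by simp)]
    · exact Set.compl_subset_compl.2 (Set.subset_insert _ _)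
  have hcard : ∀ z, z = x ∨ z = y → z ∉ Z ∧ Z.ncard + 1 = k := by
    intro z hz
    have h1 := h _ (hins z hz)
    have h2 : z ∉ Z := fun hzZ => by
      rw [Set.insert_eq_of_mem hzZ] at h1
      omega
    rw [Set.ncard_insert_of_notMem h2] at h1
    exact ⟨h2, by omega⟩
  obtain ⟨hxZ, hk⟩ := hcard x (.inl rfl)
  obtain ⟨hyZ, -⟩ := hcard y (.inr rfl)
  have hnot : ¬ Separates G A B Z := fun hs => by have := h _ hs; omega
  unfold Separates at hnot
  push Not at hnot
  obtain ⟨a, ha, b, hb, hl⟩ := hnot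
  have hedge : ∀ {a b}, Linked G Zᶜ a b → ¬ Linked (G.deleteEdges {s(x, y)}) Zᶜ a b →
      Linked (G.deleteEdges {s(x, y)}) Zᶜ a x ∨ Linked (G.deleteEdges {s(x, y)}) Zᶜ a y := by
    intro a b hl hno
    by_contra! hc
    refine hno (hl.of_closed (E := {v | Linked (G.deleteEdges {s(x, y)}) Zᶜ a v})
      (Linked.refl hl.left_mem) ?_).right_mem
    intro v hv w hw hvw
    refine Linked.trans hv (Linked.of_adj ?_ hv.right_mem hw)
    rw [SimpleGraph.deleteEdges_adj]
    refine ⟨hvw, ?_⟩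
    simp only [Set.mem_singleton_iff, Sym2.eq_iff]
    rintro (⟨rfl, rfl⟩ | ⟨rfl, rfl⟩)
    exacts [hc.1 hv, hc.2 hv]
  -- Stated for an arbitrary edge because either end may lie on the side of `A`.
  have key : ∀ x y, G.Adj x y → G.deleteEdges {s(x, y)} < G → x ∉ Z → y ∉ Z →
      Separates (G.deleteEdges {s(x, y)}) A B Z → Linked (G.deleteEdges {s(x, y)}) Zᶜ a x →
      Linked (G.deleteEdges {s(x, y)}) Zᶜ b y → DisjointlyLinked G A B k := by
    intro x y hxy hlt hxZ hyZ hZ hax hby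
    refine DisjointlyLinked.glue hlt.le hxy hZ hxZ hyZ hk (ih _ hlt fun W hW => ?_)
      (ih _ hlt fun W hW => ?_)
    · exact h W (hZ.of_insert hxy.ne ⟨b, hb, hby.symm⟩ hW)
    · refine h W (Separates.symm ?_)
      rw [Sym2.eq_swap] at hZ hax hW
      exact hZ.symm.of_insert hxy.ne' ⟨a, ha, hax.symm⟩ hW.symm
  have hno := hZ a ha b hb
  rcases hedge hl hno with hax | hay <;> rcases hedge hl.symm (fun h => hno h.symm) with hbx | hby
  · exact absurd (hax.trans hbx.symm) hno
  · exact key x y hxy hlt hxZ hyZ hZ hax hby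
  · rw [Sym2.eq_swap] at hlt hZ hay hbx
    exact key y x hxy.symm hlt hyZ hxZ hZ hay hbx
  · exact absurd (hay.trans hby.symm) hno

end Menger

/-! ### Merging and building rooted path models -/

section RootedPathModel

variable {V : Type*} {G H : SimpleGraph V} {S : Set V} {n : ℕ}

/-- `B 0, …, B (n - 1)` is a model of the path on `n` vertices in `G` whose branch sets all
meet `S`. -/
structure IsRootedPathModel (G : SimpleGraph V) (S : Set V) (n : ℕ) (B : ℕ → Set V) : Prop where
  connected : ∀ i < n, IsConnectedSet G (B i)
  rooted : ∀ i < n, (B i ∩ S).Nonempty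
  disjoint : ∀ i < n, ∀ j < n, i ≠ j → Disjoint (B i) (B j)
  adj : ∀ i, i + 1 < n → ∃ u ∈ B i, ∃ v ∈ B (i + 1), G.Adj u v

/-- The union of the branch sets. -/
def modelUnion (n : ℕ) (B : ℕ → Set V) : Set V := {v | ∃ i < n, v ∈ B i}

variable {B B' : ℕ → Set V}

theorem subset_modelUnion {i : ℕ} (hi : i < n) : B i ⊆ modelUnion n B :=
  fun _ hv => ⟨i, hi, hv⟩

theorem IsRootedPathModel.reverse (h : IsRootedPathModel G S n B) :
    IsRootedPathModel G S n fun i => B (n - 1 - i) where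
  connected i hi := h.connected _ (by omega)
  rooted i hi := h.rooted _ (by omega)
  disjoint i hi j hj hij := h.disjoint _ (by omega) _ (by omega) (by omega)
  adj i hi := by
    obtain ⟨u, hu, v, hv, huv⟩ := h.adj (n - 1 - (i + 1)) (by omega)
    rw [show n - 1 - (i + 1) + 1 = n - 1 - i by omega] at hv
    exact ⟨v, hv, u, hu, huv.symm⟩

theorem IsRootedPathModel.isConnectedSet (h : IsRootedPathModel G S n B) :
    IsConnectedSet G (modelUnion n B) := by
  have hsub : ∀ i < n, B i ⊆ modelUnion n B := fun i hi v hv => ⟨i, hi, hv⟩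
  have key : ∀ d i, i + d < n → ∀ u ∈ B i, ∀ v ∈ B (i + d), Linked G (modelUnion n B) u v := by
    intro d
    induction d with
    | zero => exact fun i hi u hu v hv => (h.connected i hi u hu v hv).mono (hsub i hi)
    | succ d ih =>
      intro i hi u hu v hv
      obtain ⟨x, hx, y, hy, hxy⟩ := h.adj (i + d) (by omega)
      have h1 := ih i (by omega) u hu x hx
      have h2 := (h.connected (i + d + 1) hi y hy v hv).mono (hsub _ hi)
      exact h1.trans ((Linked.of_adj hxy h1.right_mem h2.left_mem).trans h2)
  rintro u ⟨i, hi, hu⟩ v ⟨j, hj, hv⟩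
  rcases le_total i j with hij | hij
  · obtain ⟨d, rfl⟩ := Nat.exists_eq_add_of_le hij
    exact key d i hj u hu v hv
  · obtain ⟨d, rfl⟩ := Nat.exists_eq_add_of_le hij
    exact (key d j hi v hv u hu).symm

theorem IsRootedPathModel.mono (h : IsRootedPathModel G S n B) (hG : G ≤ H) {T : Set V}
    (hS : ∀ i < n, B i ∩ S ⊆ T) : IsRootedPathModel H T n B where
  connected i hi := (h.connected i hi).mono_graph hG
  rooted i hi := (h.rooted i hi).mono fun _ hv => ⟨hv.1, hS i hi hv⟩
  disjoint := h.disjoint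
  adj i hi := let ⟨u, hu, v, hv, huv⟩ := h.adj i hi; ⟨u, hu, v, hv, hG huv⟩

/-- Two disjoint models that are linked by a path `K` which leaves the `i`-th branch set of the
first and arrives in the `j`-th branch set of the second, where `j ≤ i`, give a longer model. -/
theorem IsRootedPathModel.merge_of_le (h : IsRootedPathModel G S n B)
    (h' : IsRootedPathModel G S n B') (hd : Disjoint (modelUnion n B) (modelUnion n B'))
    {i j : ℕ} (hj : j ≤ i) (hi : i < n) {K : Set V} {y z : V} (hy : y ∈ K)
    (hz : z ∈ B' j) (hK : IsConnectedSet G (B i ∪ K)) (hyz : G.Adj y z)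
    (hKB : ∀ v ∈ K, v ∈ modelUnion n B → v ∈ B i) (hKB' : Disjoint K (modelUnion n B')) :
    ∃ C, IsRootedPathModel G S (n + 1) C := by
  have hBB' : ∀ a < n, ∀ b < n, Disjoint (B a) (B' b) := fun a ha b hb =>
    hd.mono (subset_modelUnion ha) (subset_modelUnion hb)
  have hBK : ∀ a < n, a ≠ i → Disjoint (B a) (B i ∪ K) := by
    intro a ha hai
    refine Set.disjoint_union_right.2 ⟨h.disjoint a ha i hi hai, Set.disjoint_left.2 ?_⟩
    exact fun v hv hvK => Set.disjoint_left.1 (h.disjoint a ha i hi hai) hv (hKB v hvK ⟨a, ha, hv⟩)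
  have hKB'' : ∀ b < n, Disjoint (B i ∪ K) (B' b) := fun b hb =>
    Set.disjoint_union_left.2 ⟨hBB' i hi b hb, hKB'.mono_right (subset_modelUnion hb)⟩
  -- The sequence is `B (i - j), …, B (i - 1)`, then `B i ∪ K`, then `B' j, …, B' (n - 1)`: `j + 1 +
  -- (n - j) = n + 1` sets, where `j ≤ i` leaves enough room before `B i`.
  let C : ℕ → Set V := fun m =>
    if m < j then B (i - j + m) else if m = j then B i ∪ K else B' (m - 1)
  have hlt : ∀ m, m < j → C m = B (i - j + m) := fun m hm => by simp [C, hm]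
  have heq : C j = B i ∪ K := by simp [C]
  have hgt : ∀ m, j < m → C m = B' (m - 1) := fun m hm => by
    simp [C, show ¬ m < j by omega, show m ≠ j by omega]
  have hdisj : ∀ a b, a < b → b < n + 1 → Disjoint (C a) (C b) := by
    intro a b hab hb
    rcases lt_trichotomy a j with ha | rfl | ha
    · rw [hlt a ha]
      rcases lt_trichotomy b j with hbj | rfl | hbj
      · rw [hlt b hbj]
        exact h.disjoint _ (by omega) _ (by omega) (by omega)
      · rw [heq]
        exact hBK _ (by omega) (by omega)
      · rw [hgt b hbj]
        exact hBB' _ (by omega) _ (by omega)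
    · rw [heq, hgt b hab]
      exact hKB'' _ (by omega)
    · rw [hgt a ha, hgt b (by omega)]
      exact h'.disjoint _ (by omega) _ (by omega) (by omega)
  refine ⟨C, ⟨fun m hm => ?_, fun m hm => ?_, fun a ha b hb hab => ?_, fun m hm => ?_⟩⟩
  · rcases lt_trichotomy m j with hmj | rfl | hmj
    · rw [hlt m hmj]; exact h.connected _ (by omega)
    · rw [heq]; exact hK
    · rw [hgt m hmj]; exact h'.connected _ (by omega)
  · rcases lt_trichotomy m j with hmj | rfl | hmj
    · rw [hlt m hmj]; exact h.rooted _ (by omega)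
    · rw [heq]
      exact (h.rooted i hi).mono fun v hv => ⟨.inl hv.1, hv.2⟩
    · rw [hgt m hmj]; exact h'.rooted _ (by omega)
  · rcases lt_or_gt_of_ne hab with hab | hab
    exacts [hdisj a b hab hb, (hdisj b a hab ha).symm]
  · rcases lt_trichotomy m j with hmj | rfl | hmj
    · obtain ⟨u, hu, v, hv, huv⟩ := h.adj (i - j + m) (by omega)
      refine ⟨u, by rwa [hlt m hmj], v, ?_, huv⟩
      rcases Nat.lt_or_ge (m + 1) j with hm' | hm'
      · rw [hlt _ hm']; exact hv
      · obtain rfl : m + 1 = j := by omega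
        rw [heq]
        rw [show i - (m + 1) + m + 1 = i by omega] at hv
        exact .inl hv
    · refine ⟨y, by rw [heq]; exact .inr hy, z, ?_, hyz⟩
      rw [hgt _ (by omega)]
      exact hz
    · obtain ⟨u, hu, v, hv, huv⟩ := h'.adj (m - 1) (by omega)
      refine ⟨u, by rwa [hgt m hmj], v, ?_, huv⟩
      rw [hgt _ (by omega)]
      rwa [show m + 1 - 1 = m - 1 + 1 by omega]

theorem Linked.exists_exit {D T : Set V} {a b : V} (h : Linked G D a b) (ha : a ∉ T) (hb : b ∈ T) :
    ∃ y, Linked G (D \ T) a y ∧ ∃ t ∈ T, G.Adj y t := by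
  by_contra! hno
  refine (h.of_closed (E := {v | Linked G (D \ T) a v}) (Linked.refl ⟨h.left_mem, ha⟩)
    fun v hv w hw hvw => ?_).right_mem.right_mem.2 hb
  have hwT : w ∉ T := fun hwT => hno v hv w hwT hvw
  exact Linked.trans hv (Linked.of_adj hvw hv.right_mem ⟨hw, hwT⟩)

/-- Two disjoint rooted path models on `n ≥ 1` vertices whose roots lie in one component can be
merged into a longer one. -/
theorem IsRootedPathModel.merge (hn : 0 < n) (hS : ∀ s ∈ S, ∀ t ∈ S, Linked G Set.univ s t)
    (h : IsRootedPathModel G S n B) (h' : IsRootedPathModel G S n B')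
    (hd : Disjoint (modelUnion n B) (modelUnion n B')) :
    ∃ C, IsRootedPathModel G S (n + 1) C := by
  obtain ⟨s, hs, hsS⟩ := h.rooted 0 hn
  obtain ⟨s', hs', hsS'⟩ := h'.rooted 0 hn
  obtain ⟨x, hxU, -, hx⟩ := (hS s' hsS' s hsS).first_hit (subset_modelUnion hn hs)
  set D := insert x {v | Linked G (Set.univ \ modelUnion n B) s' v} with hD
  have hDU : ∀ v ∈ D, v ∈ modelUnion n B → v = x := fun v hv hvU =>
    hv.resolve_right fun hl => hl.right_mem.2 hvU
  -- Walk back from `x` until just before entering the second model; the connector `K` then meets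
  -- the first model only in `x` and the second not at all.
  obtain ⟨y, hy, z, hz, hyz⟩ := hx.symm.exists_exit (Set.disjoint_left.1 hd hxU)
    (subset_modelUnion hn hs')
  set K := {v | Linked G (D \ modelUnion n B') x v} with hK
  have hxK : x ∈ K := Linked.refl hy.left_mem
  have hKc : IsConnectedSet G K := isConnectedSet_component x
  obtain ⟨i, hi, hxi⟩ := hxU
  obtain ⟨j, hj, hzj⟩ := hz
  have hKU : ∀ v ∈ K, v ∈ modelUnion n B → v = x := fun v hv hvU => hDU v hv.right_mem.1 hvU
  have hKU' : Disjoint K (modelUnion n B') := Set.disjoint_left.2 fun v hv => hv.right_mem.2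
  have hconn : IsConnectedSet G (B i ∪ K) :=
    (h.connected i hi).union hKc hxi hxK (Linked.refl (.inl hxi))
  rcases le_total j i with hij | hij
  · exact h.merge_of_le h' hd hij hi hy hzj hconn hyz
      (fun v hv hvU => hKU v hv hvU ▸ hxi) hKU'
  -- Reversing both models exchanges the two orders of `i` and `j`.
  · have hrev : ∀ B : ℕ → Set V, modelUnion n (fun i => B (n - 1 - i)) ⊆ modelUnion n B := by
      rintro B v ⟨i, hi, hv⟩
      exact ⟨n - 1 - i, by omega, hv⟩
    have hi' : n - 1 - (n - 1 - i) = i := by omega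
    have hj' : n - 1 - (n - 1 - j) = j := by omega
    refine h.reverse.merge_of_le h'.reverse (hd.mono (hrev B) (hrev B')) (i := n - 1 - i)
      (j := n - 1 - j) (by omega) (by omega) hy (by rwa [hj'])
      (by rwa [hi']) hyz (fun v hv hvU => ?_) (hKU'.mono_right (hrev B'))
    rw [hKU v hv (hrev B hvU), hi']
    exact hxi

/-- In a family of pairwise intersecting connected sets, some path meets all members. -/
theorem exists_path_meeting_all [Fintype V] {F : Set (Set V)} (hF : F.Nonempty)
    (hconn : ∀ M ∈ F, IsConnectedSet G M) (hmeet : ∀ M ∈ F, ∀ M' ∈ F, (M ∩ M').Nonempty) :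
    ∃ (a b : V) (p : G.Walk a b), p.IsPath ∧ ∀ M ∈ F, ∃ v ∈ p.support, v ∈ M := by
  classical
  by_contra! hno
  -- If every path misses a member, paths grow forever. The invariant is that the path meets some
  -- member `M` only in its end, so it can be continued inside `M` to the first vertex of a missed
  -- member.
  have key : ∀ m : ℕ, ∃ (a b : V) (p : G.Walk a b), p.IsPath ∧ m ≤ p.length ∧
      ∃ M ∈ F, b ∈ M ∧ ∀ v ∈ p.support, v ∈ M → v = b := by
    intro m
    induction m with
    | zero =>
      obtain ⟨M, hM⟩ := hF
      obtain ⟨a, ha, -⟩ := hmeet M hM M hM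
      exact ⟨a, a, .nil, by simp, by simp, M, hM, ha, by simp⟩
    | succ m ih =>
      obtain ⟨a, b, p, hp, hm, M₀, hM₀, hb, hpM⟩ := ih
      obtain ⟨M, hM, hpno⟩ := hno a b p hp
      obtain ⟨y, hy₀, hy⟩ := hmeet M₀ hM₀ M hM
      obtain ⟨t, htM, ht₀, r', hr'⟩ := (hconn M₀ hM₀ b hb y hy₀).first_hit hy
      set r := r'.bypass with hr_def
      have hrp : r.IsPath := r'.bypass_isPath
      have hr : ∀ w ∈ r.support, w ∈ M₀ ∧ (w ∈ M → w = t) := by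
        intro w hw
        rcases hr' w (r'.support_bypass_subset_support hw) with rfl | hl
        · exact ⟨ht₀, fun _ => rfl⟩
        · exact ⟨hl.right_mem.1, fun h => absurd h hl.right_mem.2⟩
      have hbt : b ≠ t := fun h => hpno b p.end_mem_support (h ▸ htM)
      refine ⟨a, t, p.append r, ?_, ?_, M, hM, htM, ?_⟩
      · rw [SimpleGraph.Walk.isPath_def, SimpleGraph.Walk.support_append, List.nodup_append]
        have hnd := hrp.support_nodup
        rw [← r.cons_tail_support, List.nodup_cons] at hnd
        refine ⟨hp.support_nodup, hnd.2, fun v hv w hw hvw => ?_⟩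
        subst hvw
        have := hpM v hv (hr v (List.mem_of_mem_tail hw)).1
        exact hnd.1 (this ▸ hw)
      · have : 0 < r.length := by
          rw [Nat.pos_iff_ne_zero]
          exact fun h => hbt (SimpleGraph.Walk.eq_of_length_eq_zero h)
        rw [SimpleGraph.Walk.length_append]
        omega
      · intro v hv hvM
        rcases (SimpleGraph.Walk.mem_support_append_iff _ _).1 hv with h | h
        exacts [absurd hvM (hpno v h), (hr v h).2 hvM]
  obtain ⟨a, b, p, hp, hm, -⟩ := key (Fintype.card V)
  exact absurd hp.length_lt (by omega)

/-- A path together with `k` disjoint legs that end in `S` contains a rooted path model. -/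
theorem exists_rootedPathModel_of_legs {a b : V} {p : G.Walk a b} (hp : p.IsPath) {k : ℕ}
    {x : Fin k → ℕ} (hx : Function.Injective x) (hxp : ∀ i, x i ≤ p.length) {L : Fin k → Set V}
    (hL : ∀ i, IsConnectedSet G (L i)) (hLS : ∀ i, (L i ∩ S).Nonempty)
    (hLd : Pairwise fun i j => Disjoint (L i) (L j)) (hLx : ∀ i, p.getVert (x i) ∈ L i)
    (hLp : ∀ i, ∀ v ∈ p.support, v ∈ L i → v = p.getVert (x i)) :
    ∃ B, IsRootedPathModel G S k B := by
  classical
  let P : ℕ → Prop := fun m => ∃ i, x i = m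
  have hfin : (Set.ofPred P).Finite := Set.finite_range x
  have hcard : hfin.toFinset.card = k := by
    rw [← Set.ncard_eq_toFinset_card _ hfin]
    exact (Set.ncard_range_of_injective hx).trans (by simp)
  let L' : ℕ → Set V := Function.extend x L fun _ => ∅
  have hL' : ∀ i, L' (x i) = L i := fun i => hx.extend_apply _ _ _
  -- The stretch of the path after the previous attachment position, up to and including position
  -- `t`. Each branch set is a leg with its stretch; `Nat.nth P` lists them in path order.
  let seg : ℕ → Set V := fun t => {v | ∃ y ≤ t, (∀ z, P z → z < t → z < y) ∧ p.getVert y = v}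
  have hinj : ∀ s ≤ p.length, ∀ t ≤ p.length, p.getVert s = p.getVert t → s = t :=
    fun s hs t ht h => hp.getVert_injOn hs ht h
  have hnth : ∀ m < k, P (Nat.nth P m) := fun m hm =>
    Nat.nth_mem_of_lt_card hfin (by rwa [hcard])
  have hmono : ∀ m m', m < m' → m' < k → Nat.nth P m < Nat.nth P m' := fun m m' h h' =>
    Nat.nth_lt_nth_of_lt_card hfin h (by rwa [hcard])
  have hself : ∀ i, p.getVert (x i) ∈ seg (x i) := fun i => ⟨x i, le_rfl, fun _ _ h => h, rfl⟩
  have hseg : ∀ i, IsConnectedSet G (seg (x i)) := by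
    intro i
    have key : ∀ d y, y + d = x i → (∀ z, P z → z < x i → z < y) →
        Linked G (seg (x i)) (p.getVert y) (p.getVert (x i)) := by
      intro d
      induction d with
      | zero =>
        rintro y rfl -
        exact Linked.refl (hself i)
      | succ d ih =>
        intro y hy hz
        have h1 := ih (y + 1) (by omega) fun z hPz hzx => by have := hz z hPz hzx; omega
        refine (Linked.of_adj (p.adj_getVert_succ ?_) ?_ h1.left_mem).trans h1
        · have := hxp i
          omega
        · exact ⟨y, by omega, hz, rfl⟩
    have key' : ∀ u ∈ seg (x i), Linked G (seg (x i)) u (p.getVert (x i)) := by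
      rintro u ⟨y, hy, hz, rfl⟩
      obtain ⟨d, hd⟩ := Nat.exists_eq_add_of_le hy
      exact key d y hd.symm hz
    exact fun u hu v hv => (key' u hu).trans (key' v hv).symm
  have hdisj : ∀ i j, x i < x j → Disjoint (L i ∪ seg (x i)) (L j ∪ seg (x j)) := by
    intro i j hij
    have hne : i ≠ j := fun h => by simp [h] at hij
    have hpi := hxp i
    have hpj := hxp j
    refine Set.disjoint_union_left.2 ⟨Set.disjoint_union_right.2 ⟨hLd hne, ?_⟩,
      Set.disjoint_union_right.2 ⟨?_, ?_⟩⟩ <;> rw [Set.disjoint_left]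
    · rintro v hv ⟨y, hy, hz, rfl⟩
      have h1 := hinj _ (by omega) _ hpi (hLp i _ (p.getVert_mem_support y) hv)
      have h2 := hz (x i) ⟨i, rfl⟩ hij
      omega
    · rintro v ⟨y, hy, hz, rfl⟩ hv
      have h1 := hinj _ (by omega) _ hpj (hLp j _ (p.getVert_mem_support y) hv)
      omega
    · rintro v ⟨y, hy, hz, rfl⟩ ⟨y', hy', hz', h⟩
      have h1 := hinj _ (by omega) _ (by omega) h
      have h2 := hz' (x i) ⟨i, rfl⟩ hij
      omega
  refine ⟨fun m => L' (Nat.nth P m) ∪ seg (Nat.nth P m), ⟨?_, ?_, ?_, ?_⟩⟩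
  · intro m hm
    obtain ⟨i, hi⟩ := hnth m hm
    rw [← hi, hL']
    exact (hL i).union (hseg i) (hLx i) (hself i) (Linked.refl (.inl (hLx i)))
  · intro m hm
    obtain ⟨i, hi⟩ := hnth m hm
    rw [← hi, hL']
    exact (hLS i).mono fun v hv => ⟨.inl hv.1, hv.2⟩
  · intro m hm m' hm' hne
    obtain ⟨i, hi⟩ := hnth m hm
    obtain ⟨j, hj⟩ := hnth m' hm'
    rcases lt_or_gt_of_ne hne with h | h
    · have := hmono m m' h hm'
      rw [← hi, ← hj] at this ⊢
      rw [hL', hL']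
      exact hdisj i j this
    · have := hmono m' m h hm
      rw [← hi, ← hj] at this ⊢
      rw [hL', hL']
      exact (hdisj j i this).symm
  · intro m hm
    have hlt := hmono m (m + 1) (by omega) hm
    obtain ⟨i, hi⟩ := hnth m (by omega)
    obtain ⟨j, hj⟩ := hnth (m + 1) hm
    have hpj := hxp j
    refine ⟨p.getVert (Nat.nth P m), .inr (hi ▸ hself i), p.getVert (Nat.nth P m + 1), .inr ?_,
      p.adj_getVert_succ (by omega)⟩
    refine ⟨_, by omega, fun z hPz hz => ?_, rfl⟩
    have := Nat.le_nth_of_lt_nth_succ hz hPz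
    omega

end RootedPathModel

/-! ### Hitting sets and focused rankings -/

section FocusedRanking

variable {V : Type*} {G : SimpleGraph V} {S : Set V} {n : ℕ}

/-- If all vertices of `S` lie in one component and there is no `S`-rooted model of the path on
`n + 1` vertices, then at most `n` vertices hit all `S`-rooted models of the path on `n` vertices. -/
theorem exists_hitting_set [Fintype V] (hn : 0 < n)
    (hS : ∀ s ∈ S, ∀ t ∈ S, Linked G Set.univ s t)
    (hfree : ¬ ∃ B, IsRootedPathModel G S (n + 1) B) :
    ∃ Z : Set V, Z.ncard ≤ n ∧ ∀ B, IsRootedPathModel G S n B → (modelUnion n B ∩ Z).Nonempty := by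
  classical
  let F : Set (Set V) := {M | ∃ B, IsRootedPathModel G S n B ∧ M = modelUnion n B}
  rcases F.eq_empty_or_nonempty with hF | hF
  · refine ⟨∅, by simp, fun B hB => ?_⟩
    have : modelUnion n B ∈ F := ⟨B, hB, rfl⟩
    simp [hF] at this
  obtain ⟨a, b, p, hp, hpF⟩ := exists_path_meeting_all (G := G) hF
    (by rintro _ ⟨B, hB, rfl⟩; exact hB.isConnectedSet)
    (by
      rintro _ ⟨B, hB, rfl⟩ _ ⟨B', hB', rfl⟩
      by_contra hne
      rw [Set.not_nonempty_iff_eq_empty, ← Set.disjoint_iff_inter_eq_empty] at hne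
      exact hfree (hB.merge hn hS hB' hne))
  have hsep : ∃ Z, Separates G {v | v ∈ p.support} S Z ∧ Z.ncard < n + 1 := by
    by_contra! hno
    obtain ⟨C, hC, hl⟩ := (menger hno).symm
    choose s hs t ht hst using hl
    choose u hu huC hul using fun i => (hst i).first_hit (ht i)
    choose x hx hxp using fun i => SimpleGraph.Walk.mem_support_iff_exists_getVert.1 (hu i)
    -- Cut each link, followed from `S`, at its first vertex on the path, so that the leg meets the
    -- path only there.
    let D : Fin (n + 1) → Set V := fun i => insert (u i) {v | Linked G (C i \ {v | v ∈ p.support}) (s i) v}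
    have hDC : ∀ i, D i ⊆ C i := by
      rintro i v (rfl | hv)
      exacts [huC i, hv.right_mem.1]
    have hDp : ∀ i, ∀ v ∈ p.support, v ∈ D i → v = u i := fun i v hv hvD =>
      hvD.resolve_right fun h => h.right_mem.2 hv
    have hLD : ∀ i, {v | Linked G (D i) (s i) v} ⊆ D i := fun i v hv => Linked.right_mem hv
    have hLd : Pairwise fun i j => Disjoint {v | Linked G (D i) (s i) v} {v | Linked G (D j) (s j) v} :=
      fun i j hij => (hC hij).mono ((hLD i).trans (hDC i)) ((hLD j).trans (hDC j))
    refine hfree (exists_rootedPathModel_of_legs hp (x := x)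
      (L := fun i => {v | Linked G (D i) (s i) v}) ?_ hxp (fun i => isConnectedSet_component _)
      (fun i => ⟨s i, Linked.refl (hul i).left_mem, hs i⟩) hLd ?_ ?_)
    · intro i j hij
      by_contra hne
      have : u i = u j := by rw [← hx i, ← hx j, hij]
      exact Set.disjoint_left.1 (hC hne) (huC i) (this ▸ huC j)
    · intro i
      rw [hx i]
      exact hul i
    · intro i v hv hvL
      rw [hx i]
      exact hDp i v hv (hLD i hvL)
  obtain ⟨Z, hZ, hZn⟩ := hsep
  refine ⟨Z, by omega, fun B hB => ?_⟩
  by_contra hne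
  obtain ⟨v, hv, hvB⟩ := hpF _ ⟨B, hB, rfl⟩
  obtain ⟨s, hs, hsS⟩ := hB.rooted 0 hn
  refine hZ v hv s hsS ((hB.isConnectedSet v hvB s ⟨0, hn, hs⟩).mono fun w hw hwZ => ?_)
  exact hne ⟨w, hw, hwZ⟩

/-- The graph obtained from `G` by deleting all edges at vertices of `R`. -/
def isolate (G : SimpleGraph V) (R : Set V) : SimpleGraph V where
  Adj u v := G.Adj u v ∧ u ∉ R ∧ v ∉ R
  symm := ⟨fun _ _ h => ⟨h.1.symm, h.2.2, h.2.1⟩⟩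
  loopless := ⟨fun _ h => h.1.ne rfl⟩

theorem isolate_le (G : SimpleGraph V) (R : Set V) : isolate G R ≤ G := fun _ _ h => h.1

theorem Linked.isolate {R D : Set V} {a b : V} (h : Linked G D a b) (hD : ∀ v ∈ D, v ∉ R) :
    Linked (isolate G R) D a b := by
  refine h.head_induction (P := fun u => Linked (FanMinor.isolate G R) D u b)
    (fun hb => Linked.refl hb) ?_
  intro u v hu huv hv ih
  have huv' : (FanMinor.isolate G R).Adj u v := ⟨huv, hD u hu, hD v hv.left_mem⟩
  exact (Linked.of_adj huv' hu hv.left_mem).trans ih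

/-- Isolating `R` stands in for deleting it, with the vertex type unchanged: walks from outside
never enter `R`. -/
theorem Linked.notMem_of_isolate {R D : Set V} {a b : V} (h : Linked (FanMinor.isolate G R) D a b)
    (ha : a ∉ R) : Linked (FanMinor.isolate G R) (D \ R) a b :=
  (h.of_closed (E := {v | v ∈ D ∧ v ∉ R}) ⟨h.left_mem, ha⟩
    fun _ _ _ hy hxy => ⟨hy, hxy.2.2⟩)

theorem Linked.eq_of_isolate {R D : Set V} {a b : V} (h : Linked (FanMinor.isolate G R) D a b)
    (ha : a ∈ R) : b = a :=
  (h.of_closed (E := {a}) rfl fun _ hx _ _ hxy => absurd ha (hx ▸ hxy.2.1)).right_mem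

/-- A ranking of the vertices of `S` with `k` ranks: two vertices with the same rank less than `k`
are separated by the vertices of smaller rank, and all vertices of `S` have rank less than `k`. -/
def IsFocusedRanking (G : SimpleGraph V) (S : Set V) (k : ℕ) (f : V → ℕ) : Prop :=
  (∀ s ∈ S, f s < k) ∧
    ∀ u v, u ≠ v → f u = f v → f u < k → ¬ Linked G {w | f u ≤ f w} u v

/-- Choose a hitting set in each component and rank it first. Ranks may repeat across components, so
`n` ranks suffice for all hitting sets, and what remains has no rooted path model on `n` vertices.
Induction applies, with `(n + 1).choose 2 = n + n.choose 2`. For `n = 0` the set `S` is empty. -/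
theorem exists_focusedRanking [Fintype V] (n : ℕ) : ∀ (G : SimpleGraph V) (S : Set V),
    (¬ ∃ B, IsRootedPathModel G S (n + 1) B) →
    ∃ f, IsFocusedRanking G S ((n + 1).choose 2) f := by
  classical
  induction n with
  | zero =>
    intro G S hfree
    refine ⟨fun _ => 0, fun s hs => ?_, fun u v _ _ h => by simp at h⟩
    refine absurd ⟨fun _ => {s}, ⟨?_, ?_, ?_, ?_⟩⟩ hfree
    · rintro i - u rfl v rfl
      exact Linked.refl rfl
    · exact fun i _ => ⟨s, rfl, hs⟩
    · intro i hi j hj hij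
      omega
    · intro i hi
      omega
  | succ n ih =>
    intro G S hfree
    let comp : V → Set V := fun v => {w | Linked G Set.univ v w}
    have hcomp : ∀ {u v}, Linked G Set.univ u v → comp u = comp v := fun {u v} h =>
      Set.ext fun w => ⟨fun h' => h.symm.trans h', fun h' => h.trans h'⟩
    have hself : ∀ v, v ∈ comp v := fun v => Linked.refl (Set.mem_univ v)
    have hhit : ∀ K : Set V, (∀ s ∈ K, ∀ t ∈ K, Linked G Set.univ s t) → ∃ Z : Set V,
        Z.ncard ≤ n + 1 ∧ ∀ B, IsRootedPathModel G (S ∩ K) (n + 1) B →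
          (modelUnion (n + 1) B ∩ Z).Nonempty := fun K hK =>
      exists_hitting_set n.succ_pos (fun s hs t ht => hK s hs.2 t ht.2) fun ⟨B, hB⟩ =>
        hfree ⟨B, hB.mono le_rfl fun _ _ v hv => hv.2.1⟩
    have hcompK : ∀ v, ∀ s ∈ comp v, ∀ t ∈ comp v, Linked G Set.univ s t :=
      fun v s hs t ht => Linked.trans (Linked.symm hs) ht
    choose! Zs hZs hZhit using hhit
    have hidx : ∀ K : Set V, ∃ g : V → ℕ, (∀ v ∈ Zs K, g v < (Zs K).ncard) ∧
        Set.InjOn g (Zs K) := by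
      intro K
      let e : Zs K ≃ Fin (Zs K).ncard := Finite.equivFinOfCardEq rfl
      have he : ∀ v (hv : v ∈ Zs K), (if h : v ∈ Zs K then (e ⟨v, h⟩ : ℕ) else 0) = e ⟨v, hv⟩ :=
        fun v hv => dif_pos hv
      refine ⟨fun v => if h : v ∈ Zs K then e ⟨v, h⟩ else 0, fun v hv => ?_, fun u hu v hv h => ?_⟩
      · simp only [he v hv, Fin.is_lt]
      · simp only [he u hu, he v hv] at h
        exact congrArg Subtype.val (e.injective (Fin.ext h))
    choose idx hidx hidxinj using hidx
    set Z : Set V := {v | v ∈ Zs (comp v)} with hZ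
    -- A surviving model has roots outside `Z` and so avoids `Z`; yet it lies in one component,
    -- whose hitting set must meet it.
    obtain ⟨f', hf'S, hf'⟩ := ih (isolate G Z) (S \ Z) (by
      rintro ⟨B, hB⟩
      have hBZ : ∀ i < n + 1, ∀ v ∈ B i, v ∉ Z := by
        intro i hi v hv
        obtain ⟨s, hs, hsS⟩ := hB.rooted i hi
        have := (hB.connected i hi s hs v hv).notMem_of_isolate hsS.2
        exact this.right_mem.2
      obtain ⟨s, hs, hsS⟩ := hB.rooted 0 n.succ_pos
      have hBK : modelUnion (n + 1) B ⊆ comp s := fun v hv =>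
        ((hB.isConnectedSet s ⟨0, n.succ_pos, hs⟩ v hv).mono_graph (isolate_le G Z)).mono
          (Set.subset_univ _)
      obtain ⟨v, hvB, hvZ⟩ := hZhit _ (hcompK s) B
        (hB.mono (isolate_le G Z) fun i hi v hv => ⟨hv.2.1, hBK ⟨i, hi, hv.1⟩⟩)
      have hvs : comp v = comp s := (hcomp (hBK hvB)).symm
      obtain ⟨i, hi, hv⟩ := hvB
      exact hBZ i hi v hv (show v ∈ Zs (comp v) by rwa [hvs]))
    let f : V → ℕ := fun v => if v ∈ Z then idx (comp v) v else n + 1 + f' v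
    have hfZ : ∀ v ∈ Z, f v = idx (comp v) v := fun v hv => if_pos hv
    have hfZ' : ∀ v ∉ Z, f v = n + 1 + f' v := fun v hv => if_neg hv
    have hflt : ∀ v ∈ Z, f v < n + 1 := fun v hv => by
      rw [hfZ v hv]
      exact (hidx _ v hv).trans_le (hZs _ (hcompK v))
    have hch : (n + 1 + 1).choose 2 = n + 1 + (n + 1).choose 2 := by
      rw [Nat.choose_succ_succ' (n + 1) 1, Nat.choose_one_right]
    refine ⟨f, fun s hs => ?_, fun u v huv hfuv hfu hl => ?_⟩
    · by_cases hsZ : s ∈ Z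
      · have := hflt s hsZ
        omega
      · have := hf'S s ⟨hs, hsZ⟩
        rw [hfZ' s hsZ]
        omega
    · by_cases huZ : u ∈ Z
      · have hvZ : v ∈ Z := by
          by_contra hvZ
          have := hflt u huZ
          rw [hfuv, hfZ' v hvZ] at this
          omega
        have hc : comp u = comp v := hcomp (hl.mono (Set.subset_univ _))
        rw [hfZ u huZ, hfZ v hvZ, hc] at hfuv
        exact huv (hidxinj _ (hc ▸ huZ : u ∈ Zs (comp v)) hvZ hfuv)
      · have hwZ : ∀ w, f u ≤ f w → w ∉ Z := fun w hw hwZ => by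
          have := hflt w hwZ
          rw [hfZ' u huZ] at hw
          omega
        have hvZ : v ∉ Z := hwZ v hfuv.le
        have hfu' := hfZ' u huZ
        have hfv' := hfZ' v hvZ
        refine hf' u v huv (by omega) (by omega) ((hl.isolate hwZ).mono fun w hw => ?_)
        have h1 : f u ≤ f w := hw
        have h2 := hfZ' w (hwZ w hw)
        show f' u ≤ f' w
        omega

end FocusedRanking

/-! ### From rankings to elimination forests -/

section Forest

variable {V : Type*} {G : SimpleGraph V} {k : ℕ} {f : V → ℕ} {u v w : V}

/-- `u` can be reached from `v` without passing through vertices whose rank is smaller than that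
of `u`. -/
def IsAncestor (G : SimpleGraph V) (f : V → ℕ) (u v : V) : Prop :=
  Linked G {w | f u ≤ f w} u v

theorem IsAncestor.refl (G : SimpleGraph V) (f : V → ℕ) (v : V) : IsAncestor G f v v :=
  Linked.refl (le_refl (f v))

theorem IsAncestor.rank_le (h : IsAncestor G f u v) : f u ≤ f v := h.right_mem

theorem IsAncestor.trans (h : IsAncestor G f u v) (h' : IsAncestor G f v w) :
    IsAncestor G f u w :=
  Linked.trans h (Linked.mono h' fun _ hw => h.rank_le.trans hw)

/-- The ancestors of a vertex form a chain: going through `w` never drops below the smaller rank. -/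
theorem IsAncestor.of_rank_le (hu : IsAncestor G f u w) (hv : IsAncestor G f v w)
    (h : f u ≤ f v) : IsAncestor G f u v :=
  Linked.trans hu (Linked.symm (Linked.mono hv fun _ hw => h.trans hw))

theorem IsFocusedRanking.eq_of_isAncestor (hf : IsFocusedRanking G Set.univ k f)
    (hu : IsAncestor G f u w) (hv : IsAncestor G f v w) (h : f u = f v) : u = v := by
  by_contra hne
  exact hf.2 u v hne h (hf.1 u trivial) (hu.of_rank_le hv h.le)

/-- The parent is the proper ancestor of largest rank; `par v = v` marks a root. -/
theorem IsFocusedRanking.exists_parent [Finite V] (hf : IsFocusedRanking G Set.univ k f) :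
    ∃ par : V → V, (∀ v, par v ≠ v → IsAncestor G f (par v) v ∧ f (par v) < f v) ∧
      ∀ u v, IsAncestor G f u v → u ≠ v → par v ≠ v ∧ IsAncestor G f u (par v) := by
  have key : ∀ v, ∃ w, (w ≠ v → IsAncestor G f w v ∧ f w < f v) ∧
      ∀ u, IsAncestor G f u v → u ≠ v → w ≠ v ∧ IsAncestor G f u w := by
    intro v
    rcases {u | IsAncestor G f u v ∧ u ≠ v}.eq_empty_or_nonempty with he | he
    · refine ⟨v, fun h => absurd rfl h, fun u hu huv => ?_⟩
      have : u ∈ {u | IsAncestor G f u v ∧ u ≠ v} := ⟨hu, huv⟩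
      simp [he] at this
    · obtain ⟨w, ⟨hw, hwv⟩, hmax⟩ := Set.exists_max_image _ f (Set.toFinite _) he
      refine ⟨w, fun _ => ⟨hw, lt_of_le_of_ne hw.rank_le fun h => hwv ?_⟩, fun u hu huv => ⟨hwv, ?_⟩⟩
      · exact hf.eq_of_isAncestor hw (IsAncestor.refl G f v) h
      · exact hu.of_rank_le hw (hmax u ⟨hu, huv⟩)
  choose par h1 h2 using key
  exact ⟨par, h1, fun u v => h2 v u⟩

/-- The graph in which every vertex is joined to its parent. -/
def parentGraph (par : V → V) : SimpleGraph V := SimpleGraph.fromRel fun u v => par u = v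

variable {par : V → V}

theorem parentGraph_adj : (parentGraph par).Adj u v ↔ u ≠ v ∧ (par u = v ∨ par v = u) :=
  SimpleGraph.fromRel_adj _ _ _

/-- On a cycle, both neighbours of a vertex of largest rank would have to be its parent. -/
theorem parentGraph_isAcyclic (hpar : ∀ v, par v ≠ v → f (par v) < f v) :
    (parentGraph par).IsAcyclic := by
  classical
  intro v c hc
  obtain ⟨w, hw, hmax⟩ := c.support.toFinset.exists_max_image f ⟨v, by simp⟩
  rw [List.mem_toFinset] at hw
  have hmax' : ∀ x ∈ (c.rotate w hw).support, f x ≤ f w := fun x hx =>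
    hmax x (by simpa using hx)
  have hc' := hc.rotate hw
  have key : ∀ x ∈ (c.rotate w hw).support, (parentGraph par).Adj w x → x = par w := by
    intro x hx hwx
    obtain ⟨hne, h | h⟩ := parentGraph_adj.1 hwx
    · exact h.symm
    · have h1 := hpar x (h ▸ hne)
      rw [h] at h1
      exact absurd (hmax' x hx) (by omega)
  refine hc'.snd_ne_penultimate ((key _ ?_ ?_).trans (key _ ?_ ?_).symm)
  · exact SimpleGraph.Walk.getVert_mem_support _ _
  · exact SimpleGraph.Walk.adj_snd hc'.not_nil
  · exact SimpleGraph.Walk.getVert_mem_support _ _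
  · exact (SimpleGraph.Walk.adj_penultimate hc'.not_nil).symm

/-- A path whose first step cannot go to a parent can never turn upwards later, since each vertex
below the start has its parent already behind it. -/
theorem isAncestor_of_mem_support
    (hpar : ∀ v, par v ≠ v → IsAncestor G f (par v) v ∧ f (par v) < f v)
    (p : (parentGraph par).Walk u v) (hp : p.IsPath) (hu : par u = u ∨ par u ∉ p.support) :
    ∀ w ∈ p.support, IsAncestor G f w v := by
  induction p with
  | nil =>
    intro w hw
    obtain rfl : w = _ := by simpa using hw
    exact IsAncestor.refl G f w
  | @cons x y z hxy q ih =>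
    rw [SimpleGraph.Walk.cons_isPath_iff] at hp
    obtain ⟨hne, hpx | hpy⟩ := parentGraph_adj.1 hxy
    · rcases hu with hu | hu
      · exact absurd (hu.symm.trans hpx) hne
      · exact absurd (by simp [hpx]) hu
    · have hq := ih hp.1 (.inr (hpy ▸ hp.2))
      intro w hw
      rw [SimpleGraph.Walk.support_cons, List.mem_cons] at hw
      rcases hw with rfl | hw
      · have h1 := (hpar y (hpy ▸ hne)).1
        rw [hpy] at h1
        exact h1.trans (hq y q.start_mem_support)
      · exact hq w hw

/-- A ranking of all vertices with `k` ranks yields an elimination forest of height at most `k`. -/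
theorem IsFocusedRanking.treedepth_le [Fintype V] (hf : IsFocusedRanking G Set.univ k f) :
    treedepth G ≤ k := by
  classical
  obtain ⟨par, hpar, hanc⟩ := hf.exists_parent
  have hroot : ∀ c : (parentGraph par).ConnectedComponent, ∃ r,
      (parentGraph par).connectedComponentMk r = c ∧ par r = r := by
    intro c
    obtain ⟨r, hr, hmin⟩ := Set.exists_min_image c.supp f (Set.toFinite _) c.nonempty_supp
    refine ⟨r, hr, ?_⟩
    by_contra hne
    have hadj : (parentGraph par).Adj (par r) r := parentGraph_adj.2 ⟨hne, .inr rfl⟩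
    have hmem : par r ∈ c.supp :=
      (SimpleGraph.ConnectedComponent.connectedComponentMk_eq_of_adj hadj).trans hr
    exact absurd (hmin _ hmem) (by have := (hpar r hne).2; omega)
  choose root hroot_mem hroot_par using hroot
  let F : RootedForest V :=
    ⟨parentGraph par, parentGraph_isAcyclic fun v hv => (hpar v hv).2, root, hroot_mem⟩
  have hdesc : ∀ u v, F.IsDescendant u v → IsAncestor G f v u := by
    rintro u v ⟨p, hp, hv⟩
    exact isAncestor_of_mem_support hpar p hp (.inl (hroot_par _)) v hv
  have hdesc' : ∀ m u v, f u = m → IsAncestor G f v u → F.IsDescendant u v := by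
    intro m
    induction m using Nat.strong_induction_on with
    | _ m ih =>
    rintro u v rfl hvu
    by_cases hne : v = u
    · subst hne
      have hreach : (parentGraph par).Reachable (F.rootOf v) v :=
        SimpleGraph.ConnectedComponent.exact (hroot_mem _)
      obtain ⟨p, hp⟩ := hreach.exists_isPath
      exact ⟨p, hp, p.end_mem_support⟩
    · obtain ⟨hpu, hvp⟩ := hanc v u hvu hne
      obtain ⟨q, hq, hvq⟩ := ih _ (hpar u hpu).2 (par u) v rfl hvp
      have hadj : (parentGraph par).Adj (par u) u := parentGraph_adj.2 ⟨hpu, .inr rfl⟩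
      have hro : F.rootOf (par u) = F.rootOf u :=
        congrArg root (SimpleGraph.ConnectedComponent.connectedComponentMk_eq_of_adj hadj)
      have huq : u ∉ q.support := fun hu => by
        have h1 := (hdesc (par u) u ⟨q, hq, hu⟩).rank_le
        have h2 := (hpar u hpu).2
        omega
      refine ⟨(q.concat hadj).copy hro rfl, ?_, ?_⟩
      · simpa using hq.concat huq hadj
      · simp [SimpleGraph.Walk.support_concat, hvq]
  have helim : F.IsEliminationForest G := by
    intro u v huv
    rw [RootedForest.closure, SimpleGraph.fromRel_adj]
    refine ⟨huv.ne, ?_⟩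
    rcases le_total (f u) (f v) with h | h
    · exact .inr (hdesc' _ v u rfl (Linked.of_adj huv (le_refl (f u)) h))
    · exact .inl (hdesc' _ u v rfl (Linked.of_adj huv.symm (le_refl (f v)) h))
  have hmin : treedepth G ≤ F.vertexHeight := Nat.sInf_le ⟨F, helim, rfl⟩
  -- Ancestors of one vertex have distinct ranks below `k`, which bounds its depth.
  refine hmin.trans (Finset.sup_le fun u _ => ?_)
  have := Set.ncard_le_ncard_of_injOn (s := {v | F.IsDescendant u v}) (t := Set.Iio k) f
    (fun v _ => hf.1 v trivial)
    (fun v hv w hw h => hf.eq_of_isAncestor (hdesc u v hv) (hdesc u w hw) h) (Set.toFinite _)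
  refine this.trans ?_
  simp

end Forest

/-! ### Fans, balls and stacked rankings -/

section Fan

variable {V W : Type*} {G : SimpleGraph V}

/-- A fan on `n + 1` vertices is a subgraph of the path on `n` vertices plus a dominating vertex. -/
theorem IsFan.exists_embedding [Fintype W] {X : SimpleGraph W} (hX : IsFan X) {n : ℕ}
    (hn : Fintype.card W = n + 1) :
    ∃ (w : W) (φ : W → ℕ), (∀ v, v ≠ w → φ v < n) ∧
      (∀ u v, u ≠ w → v ≠ w → φ u = φ v → u = v) ∧
      ∀ u v, u ≠ w → v ≠ w → X.Adj u v → φ u + 1 = φ v ∨ φ v + 1 = φ u := by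
  classical
  rcases hX with ⟨m, ⟨e⟩⟩ | ⟨w, m, ⟨e⟩⟩
  · obtain rfl : m = n + 1 := by
      rw [← hn, Fintype.card_congr e.toEquiv, Fintype.card_fin]
    -- If `X` is itself a path, its last vertex plays the apex.
    refine ⟨e.symm (Fin.last n), fun v => e v, fun v hv => ?_, fun u v _ _ h => ?_,
      fun u v _ _ h => SimpleGraph.pathGraph_adj.1 (e.map_adj_iff.2 h)⟩
    · have h1 : e v ≠ Fin.last n := fun h => hv (by rw [← h, e.symm_apply_apply])
      have h2 := Fin.val_lt_last h1
      exact h2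
    · exact e.injective (Fin.ext h)
  · have hm : m = n := by
      have h1 := Fintype.card_congr e.toEquiv
      rw [Fintype.card_fin] at h1
      have h2 : Fintype.card ({w}ᶜ : Set W) = n := by
        rw [Fintype.card_compl_set, hn]
        simp
      omega
    subst hm
    refine ⟨w, fun v => if h : v ≠ w then e ⟨v, h⟩ else 0, fun v hv => ?_, fun u v hu hv h => ?_,
      fun u v hu hv h => ?_⟩
    · simp [hv]
    · simp only [hu, hv, ne_eq, not_false_eq_true, dif_pos] at h
      exact congrArg Subtype.val (e.injective (Fin.ext h))
    · simp only [hu, hv, ne_eq, not_false_eq_true, dif_pos]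
      refine SimpleGraph.pathGraph_adj.1 (e.map_adj_iff.2 ?_)
      exact h

/-- A connected set `R` together with a path model outside of `R`, each of whose branch sets has a
neighbour in `R`, gives a model of every fan with one more vertex. -/
theorem IsFan.isMinor_of_rootedPathModel [Fintype W] {X : SimpleGraph W} (hX : IsFan X) {n : ℕ}
    (hn : Fintype.card W = n + 1) {R : Set V} (hR : IsConnectedSet G R) (hRne : R.Nonempty)
    {S : Set V} (hS : ∀ s ∈ S, ∃ r ∈ R, G.Adj r s) {B : ℕ → Set V}
    (hB : IsRootedPathModel G S n B) (hBR : ∀ i < n, Disjoint R (B i)) : IsMinor X G := by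
  classical
  obtain ⟨w, φ, hφ, hinj, hadj⟩ := hX.exists_embedding hn
  have hC : ∀ v, v ≠ w → (if v = w then R else B (φ v)) = B (φ v) := fun v hv => if_neg hv
  have hind : ∀ {C D : Set V}, C = D → (G.induce D).Connected → (G.induce C).Connected := by
    rintro _ _ rfl h
    exact h
  have hwv : ∀ v, v ≠ w → ∃ r ∈ R, ∃ s ∈ B (φ v), G.Adj r s := fun v hv => by
    obtain ⟨s, hs, hsS⟩ := hB.rooted _ (hφ v hv)
    obtain ⟨r, hr, hrs⟩ := hS s hsS
    exact ⟨r, hr, s, hs, hrs⟩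
  refine ⟨fun v => if v = w then R else B (φ v), ⟨fun u v huv => ?_, fun v => ?_, fun u v huv => ?_⟩⟩
  · by_cases hu : u = w
    · subst hu
      simp only [hC v huv.symm, if_true]
      exact hBR _ (hφ v huv.symm)
    · by_cases hv : v = w
      · subst hv
        simp only [hC u huv, if_true]
        exact (hBR _ (hφ u huv)).symm
      · simp only [hC u hu, hC v hv]
        exact hB.disjoint _ (hφ u hu) _ (hφ v hv) fun h => huv (hinj u v hu hv h)
  · by_cases hv : v = w
    · exact hind (if_pos hv) (hR.induce_connected hRne)
    · refine hind (hC v hv) ?_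
      exact (hB.connected _ (hφ v hv)).induce_connected
        ((hB.rooted _ (hφ v hv)).mono Set.inter_subset_left)
  · by_cases hu : u = w
    · subst hu
      simp only [hC v huv.ne', if_true]
      exact hwv v huv.ne'
    · by_cases hv : v = w
      · subst hv
        simp only [hC u hu, if_true]
        obtain ⟨r, hr, s, hs, hrs⟩ := hwv u hu
        exact ⟨s, hs, r, hr, hrs.symm⟩
      · simp only [hC u hu, hC v hv]
        have key : ∀ a b, φ a + 1 = φ b → b ≠ w → ∃ x ∈ B (φ a), ∃ y ∈ B (φ b), G.Adj x y :=
          fun a b hab hb => by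
            obtain ⟨x, hx, y, hy, hxy⟩ := hB.adj (φ a) (hab ▸ hφ b hb)
            exact ⟨x, hx, y, hab ▸ hy, hxy⟩
        rcases hadj u v hu hv huv with h | h
        · exact key u v h hv
        · obtain ⟨x, hx, y, hy, hxy⟩ := key v u h hu
          exact ⟨y, hy, x, hx, hxy.symm⟩

/-- Balls in a connected graph are connected sets. -/
theorem isConnectedSet_ball (hG : G.Connected) (r : V) (i : ℕ) :
    IsConnectedSet G {v | G.dist r v ≤ i} := by
  have key : ∀ v ∈ {v | G.dist r v ≤ i}, Linked G {v | G.dist r v ≤ i} r v := by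
    intro v hv
    obtain ⟨p, hp⟩ := hG.exists_walk_length_eq_dist r v
    refine ⟨p, fun w hw => ?_⟩
    obtain ⟨q, q', rfl⟩ := SimpleGraph.Walk.mem_support_iff_exists_append.1 hw
    have h1 := SimpleGraph.dist_le q
    rw [SimpleGraph.Walk.length_append] at hp
    have h2 : G.dist r v ≤ i := hv
    show G.dist r w ≤ i
    omega
  exact fun u hu v hv => (key u hu).symm.trans (key v hv)

theorem exists_adj_dist_eq (hG : G.Connected) {r s : V} {i : ℕ} (hs : G.dist r s = i + 1) :
    ∃ v, G.dist r v ≤ i ∧ G.Adj v s := by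
  obtain ⟨p, hp⟩ := hG.exists_walk_length_eq_dist r s
  have hnil : ¬ p.Nil := by
    rw [SimpleGraph.Walk.not_nil_iff_lt_length]
    omega
  refine ⟨p.penultimate, ?_, p.adj_penultimate hnil⟩
  have h1 := SimpleGraph.dist_le p.dropLast
  rw [SimpleGraph.Walk.length_dropLast] at h1
  omega

/-- If the graphs outside of all balls around `r` have rankings with `k` ranks that are focused on
the boundaries of the balls, then these combine to a ranking outside of a given ball. -/
theorem exists_ranking_outside_ball (r : V) {k D : ℕ} (hD : ∀ v, G.dist r v ≤ D)
    (h : ∀ i, ∃ f, IsFocusedRanking (isolate G {v | G.dist r v ≤ i}) {v | G.dist r v = i + 1} k f) :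
    ∀ j i, i + j = D → ∃ f : V → ℕ, (∀ v, i < G.dist r v → f v < k * j) ∧
      ∀ u v, u ≠ v → f u = f v → i < G.dist r u → i < G.dist r v →
        ¬ Linked G ({w | f u ≤ f w} ∩ {w | i < G.dist r w}) u v := by
  classical
  intro j
  induction j with
  | zero =>
    intro i hi
    have hno : ∀ v, ¬ i < G.dist r v := fun v hv => by have := hD v; omega
    exact ⟨fun _ => 0, fun v hv => absurd hv (hno v), fun u v _ _ hu => absurd hu (hno u)⟩
  | succ j ih =>
    intro i hi
    obtain ⟨g, hgS, hg⟩ := h i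
    obtain ⟨f', hf'k, hf'⟩ := ih (i + 1) (by omega)
    -- Vertices that `g` leaves unranked lie beyond the sphere of radius `i + 1`, so `f'` ranks
    -- them, shifted past the `k` ranks of `g`.
    let f : V → ℕ := fun v => if g v < k then g v else k + f' v
    have hlt : ∀ v, g v < k → f v = g v := fun v hv => if_pos hv
    have hge : ∀ v, ¬ g v < k → f v = k + f' v := fun v hv => if_neg hv
    have hout : ∀ v, ¬ g v < k → i < G.dist r v → i + 1 < G.dist r v := fun v hv hd => by
      by_contra hcon
      exact hv (hgS v (show G.dist r v = i + 1 by omega))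
    refine ⟨f, fun v hv => ?_, fun u v huv hfuv hu hv hl => ?_⟩
    · rw [Nat.mul_succ]
      by_cases hgv : g v < k
      · rw [hlt v hgv]
        omega
      · rw [hge v hgv]
        have := hf'k v (hout v hgv hv)
        omega
    · by_cases hgu : g u < k
      · have hfu := hlt u hgu
        have hgv : g v < k := by
          by_contra hgv
          have := hge v hgv
          omega
        have hfv := hlt v hgv
        have hl' := hl.isolate (R := {v | G.dist r v ≤ i}) fun w hw (hwR : G.dist r w ≤ i) =>
          absurd (show i < G.dist r w from hw.2) (not_lt.2 hwR)
        refine hg u v huv (by omega) hgu (hl'.mono fun w hw => ?_)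
        have h1 : f u ≤ f w := hw.1
        show g u ≤ g w
        by_cases hgw : g w < k
        · rw [← hfu, ← hlt w hgw]
          exact h1
        · omega
      · have hfu := hge u hgu
        have hgw : ∀ w, f u ≤ f w → ¬ g w < k := fun w hw hgw => by
          have := hlt w hgw
          omega
        have hgv := hgw v hfuv.le
        have hfv := hge v hgv
        refine hf' u v huv (by omega) (hout u hgu hu) (hout v hgv hv) (hl.mono fun w hw => ?_)
        have h1 : f u ≤ f w := hw.1
        have h2 := hge w (hgw w h1)
        exact ⟨show f' u ≤ f' w by omega, hout w (hgw w h1) hw.2⟩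

end Fan
end FanMinor

/-! ### The treedepth bound -/

theorem mainTheorem9 {W V : Type*} [Fintype W] [Fintype V]
    (X : SimpleGraph W) (hX : FanMinor.IsFan X) (hcard : 3 ≤ Fintype.card W)
    (G : SimpleGraph V) (hG : G.Preconnected) (hfree : ¬ FanMinor.IsMinor X G) :
    FanMinor.treedepth G ≤ (Fintype.card W - 1).choose 2 * (G.diam + 1) := by
  classical
  rcases isEmpty_or_nonempty V with hV | ⟨⟨r⟩⟩
  · have : FanMinor.IsFocusedRanking G Set.univ 0 fun _ => 0 :=
      ⟨fun v => (hV.false v).elim, fun v => (hV.false v).elim⟩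
    exact this.treedepth_le.trans (Nat.zero_le _)
  have hne : Nonempty V := ⟨r⟩
  have hconn : G.Connected := SimpleGraph.Connected.mk hG
  obtain ⟨n, hn⟩ : ∃ n, Fintype.card W = n + 1 + 1 := ⟨Fintype.card W - 2, by omega⟩
  rw [show Fintype.card W - 1 = n + 1 by omega]
  set k := (n + 1).choose 2 with hk
  -- Needs at least three vertices in `X`; it pays for the extra rank of `r`, as `k * diam + 1 ≤ k *
  -- (diam + 1)`.
  have hkpos : 0 < k := Nat.choose_pos (by omega)
  have hfocus : ∀ i, ∃ f, FanMinor.IsFocusedRanking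
      (FanMinor.isolate G {v | G.dist r v ≤ i}) {v | G.dist r v = i + 1} k f := by
    intro i
    refine FanMinor.exists_focusedRanking n _ _ ?_
    rintro ⟨B, hB⟩
    refine hfree (hX.isMinor_of_rootedPathModel hn (FanMinor.isConnectedSet_ball hconn r i)
      ⟨r, by simp⟩ (fun s hs => FanMinor.exists_adj_dist_eq hconn hs)
      (hB.mono (FanMinor.isolate_le _ _) fun _ _ v hv => hv.2) fun j hj => ?_)
    obtain ⟨s, hs, hsS⟩ := hB.rooted j hj
    refine Set.disjoint_left.2 fun v hvR hv => ?_
    -- A ball vertex is isolated, so it could only be the root `s` itself, which lies outside the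
    -- ball.
    have hsv := hB.connected j hj v hv s hs
    obtain rfl := hsv.eq_of_isolate hvR
    have h1 : G.dist r s ≤ i := hvR
    have h2 : G.dist r s = i + 1 := hsS
    omega
  have hD : ∀ v, G.dist r v ≤ G.diam := fun v =>
    SimpleGraph.dist_le_diam (SimpleGraph.connected_iff_ediam_ne_top.1 hconn)
  obtain ⟨f, hfk, hf⟩ := FanMinor.exists_ranking_outside_ball r hD hfocus G.diam 0 (zero_add _)
  have hpos : ∀ v, v ≠ r → 0 < G.dist r v := fun v hv => hconn.pos_dist_of_ne hv.symm
  let g : V → ℕ := fun v => if v = r then 0 else f v + 1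
  have hgr : g r = 0 := if_pos rfl
  have hg : ∀ v, v ≠ r → g v = f v + 1 := fun v hv => if_neg hv
  have hrank : FanMinor.IsFocusedRanking G Set.univ (k * (G.diam + 1)) g := by
    refine ⟨fun v _ => ?_, fun u v huv hguv _ hl => ?_⟩
    · rw [Nat.mul_succ]
      by_cases hv : v = r
      · rw [hv, hgr]
        omega
      · have := hfk v (hpos v hv)
        rw [hg v hv]
        omega
    · by_cases hu : u = r
      · have hv : v ≠ r := fun hv => huv (hu.trans hv.symm)
        rw [hu, hgr, hg v hv] at hguv
        omega
      · have hgu := hg u hu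
        have hw : ∀ w, g u ≤ g w → w ≠ r := by
          rintro w hw rfl
          omega
        have hv := hw v hguv.le
        have hgv := hg v hv
        refine hf u v huv (by omega) (hpos u hu) (hpos v hv) (hl.mono fun w hgw => ?_)
        have h1 : g u ≤ g w := hgw
        have h2 := hg w (hw w h1)
        exact ⟨show f u ≤ f w by omega, hpos w (hw w h1)⟩
  exact hrank.treedepth_le
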